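/- Let $A$ be a natural uniform algebra on a non-empty compact Hausdorff space $K$; that is, $A$ is a unital subalgebra of $C(K)=C(K,\mathbb C)$ which is closed in the uniform norm, separates the points of $K$, and is such that every character of $A$ has the form $f\mapsto f(x)$ for some $x\in K$, so that $K$ is identified with the character space $\Phi_A$ of $A$. For $\varphi\in\Phi_A=K$, let $M_\varphi=\{f\in A: f(\varphi)=0\}$ be the corresponding maximal ideal. A closed set $F\subset \Phi_A$ is a peak set for $A$ if there is $f\in A$ with $|f(x)|=1$ for $x\in F$ and $|f(y)|<1$ for $y\in\Phi_A\setminus F$, and $\varphi\in\Phi_A$ is a strong boundary point of $A$ if $\{\varphi\}$ is an intersection of peak sets; $S_0(A)$ denotes the set of strong boundary points. Suppose that $S_0(A)$ is countable and that, for each $\varphi\in S_0(A)$, the ideal $M_\varphi$ is (algebraically) countably generated, i.e. there is a countable set $S\subset A$ such that $M_\varphi$ is the ideal of $A$ generated by $S$. Then $A$ is finite-dimensional. -/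

import Mathlib

namespace UniformAlg

variable {K : Type*} [TopologicalSpace K]

/-- `A` is a uniform algebra on the compact space `K`: a unital subalgebra of `C(K)` that is closed
in the uniform norm (on compact `K` this is the topology of `C(K, ℂ)`) and separates the points
of `K`. -/
structure IsUniformAlgebra (A : Subalgebra ℂ C(K, ℂ)) : Prop where
  isClosed : IsClosed (A : Set C(K, ℂ))
  separatesPoints : A.SeparatesPoints

/-- `A` is natural on `K`: every character of `A` is the evaluation at a point of `K`. When `A`
separates points, this identifies `K` with the character space of `A`. -/
def IsNatural (A : Subalgebra ℂ C(K, ℂ)) : Prop :=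
  ∀ φ : A →ₐ[ℂ] ℂ, ∃ x : K, ∀ f : A, φ f = (f : C(K, ℂ)) x

/-- The closed set `F` is a peak set for `A`: some `f ∈ A` has `|f| = 1` on `F` and `|f| < 1`
off `F`. -/
def IsPeakSet (A : Subalgebra ℂ C(K, ℂ)) (F : Set K) : Prop :=
  IsClosed F ∧ ∃ f ∈ A, (∀ x ∈ F, ‖f x‖ = 1) ∧ ∀ y ∉ F, ‖f y‖ < 1

/-- The set `S₀(A)` of strong boundary points: the points `x` such that `{x}` is an intersection of
peak sets. -/
def strongBoundary (A : Subalgebra ℂ C(K, ℂ)) : Set K :=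
  {x | ∃ 𝓕 : Set (Set K), (∀ F ∈ 𝓕, IsPeakSet A F) ∧ ⋂₀ 𝓕 = {x}}

/-- The character of `A` given by evaluation at `x`. -/
noncomputable def evalAt (A : Subalgebra ℂ C(K, ℂ)) (x : K) : A →ₐ[ℂ] ℂ :=
  (ContinuousMap.evalAlgHom ℂ ℂ x).comp A.val

/-- The maximal ideal `M_x = {f ∈ A : f x = 0}`, the kernel of the character at `x`. -/
noncomputable def maxIdeal (A : Subalgebra ℂ C(K, ℂ)) (x : K) : Ideal A :=
  RingHom.ker (evalAt A x)

/-- The ideal `I` is generated, algebraically, by a countable set. -/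
def IsCountablyGenerated {R : Type*} [CommRing R] (I : Ideal R) : Prop :=
  ∃ S : Set R, S.Countable ∧ Ideal.span S = I

end UniformAlg

open Set Filter Topology

namespace UniformAlg

variable {K : Type*} [TopologicalSpace K]

/-! At a strong boundary point `x`, Banach–Steinhaus on `M_x` gives a continuous weight `w` with `w
x = 0` and `|g| ≤ C‖g‖w` for all `g ∈ M_x` (`exists_weight`). For `y ≠ x` some `1 - f ∈ M_x` has
norm at most 2 and modulus at least 1/2 at `y`; so `w` is bounded below off `x`, and `x` is
isolated. Its indicator `e_x` then lies in `A`. A point outside the strong boundary would lie in the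
common set where all `1 - e_x` equal 1, an intersection of peak sets missing every strong boundary
point. This contradicts `exists_mem_strongBoundary`, which rests on Zorn and the norm-preserving
`exists_extension`. So `K` is discrete and compact, hence finite. -/

/-- The common set where all functions of `S` take the value `1`. -/
def peakOn (S : Set C(K, ℂ)) : Set K := {y | ∀ f ∈ S, f y = 1}

/-- The functions in `A` bounded by `1` in modulus. -/
def unitBall (A : Subalgebra ℂ C(K, ℂ)) : Set C(K, ℂ) := {f | f ∈ A ∧ ∀ y, ‖f y‖ ≤ 1}

/-! ### Peaking functions -/

/-- Strict convexity of the disc: averaging with 1 turns "`f ≠ 1`" into "modulus less than 1". -/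
theorem eq_one_of_norm_half_one_add {z : ℂ} (hz : ‖z‖ ≤ 1) (h : 1 ≤ ‖(1 / 2 : ℂ) * (1 + z)‖) :
    z = 1 := by
  rw [norm_mul] at h
  norm_num at h
  have h2 : 4 ≤ ‖1 + z‖ ^ 2 := by nlinarith
  have h1 : ‖z‖ ^ 2 ≤ 1 := by nlinarith [norm_nonneg z]
  rw [Complex.sq_norm, Complex.normSq_apply] at h1 h2
  simp only [Complex.add_re, Complex.add_im, Complex.one_re, Complex.one_im] at h2
  apply Complex.ext
  · simp only [Complex.one_re]; nlinarith
  · simp only [Complex.one_im]; nlinarith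

theorem norm_half_one_add_le {z : ℂ} (hz : ‖z‖ ≤ 1) : ‖(1 / 2 : ℂ) * (1 + z)‖ ≤ 1 := by
  have := norm_add_le 1 z
  rw [norm_mul]
  norm_num at this ⊢
  linarith

theorem half_one_add_mem {A : Subalgebra ℂ C(K, ℂ)} {f : C(K, ℂ)} (hf : f ∈ A) :
    (1 / 2 : ℂ) • (1 + f) ∈ A :=
  A.smul_mem (A.add_mem A.one_mem hf) _

/-- Functions of `A` equal to `1` on `peakOn S` can be made small off a neighbourhood of it. -/
theorem exists_small_off [CompactSpace K] {A : Subalgebra ℂ C(K, ℂ)} {S : Set C(K, ℂ)}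
    (hS : S ⊆ unitBall A) {V : Set K} (hV : IsOpen V) (hSV : peakOn S ⊆ V) {ε : ℝ} (hε : 0 < ε) :
    ∃ f ∈ unitBall A, (∀ y ∈ peakOn S, f y = 1) ∧ ∀ y ∉ V, ‖f y‖ ≤ ε := by
  refine hV.isClosed_compl.isCompact.induction_on
    (p := fun s => ∃ f ∈ unitBall A, (∀ y ∈ peakOn S, f y = 1) ∧ ∀ y ∈ s, ‖f y‖ ≤ ε) ?_ ?_ ?_ ?_
  · exact ⟨1, ⟨A.one_mem, by simp⟩, by simp, by simp⟩
  · rintro s t hst ⟨f, hf, h1, h2⟩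
    exact ⟨f, hf, h1, fun y hy => h2 y (hst hy)⟩
  · rintro s t ⟨f, hf, hf1, hfs⟩ ⟨g, hg, hg1, hgt⟩
    refine ⟨f * g, ⟨A.mul_mem hf.1 hg.1, fun y => ?_⟩, fun y hy => ?_, fun y hy => ?_⟩
    · rw [ContinuousMap.mul_apply, norm_mul]
      exact mul_le_one₀ (hf.2 y) (norm_nonneg _) (hg.2 y)
    · rw [ContinuousMap.mul_apply, hf1 y hy, hg1 y hy, one_mul]
    · rw [ContinuousMap.mul_apply, norm_mul]
      rcases hy with hy | hy
      · exact (mul_le_of_le_one_right (norm_nonneg _) (hg.2 y)).trans (hfs y hy)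
      · exact (mul_le_of_le_one_left (norm_nonneg _) (hf.2 y)).trans (hgt y hy)
  · intro y hy
    obtain ⟨f, hfS, hfy⟩ : ∃ f ∈ S, f y ≠ 1 := by
      by_contra! h
      exact hy (hSV h)
    have hf := hS hfS
    -- `f y` may be another unimodular number, so powers of `f` need not decay; powers of the
    -- average do.
    set u : C(K, ℂ) := (1 / 2 : ℂ) • (1 + f) with hu
    have hu1 : ∀ z, ‖u z‖ ≤ 1 := fun z => norm_half_one_add_le (hf.2 z)
    have huy : ‖u y‖ < 1 := by
      by_contra! h
      exact hfy (eq_one_of_norm_half_one_add (hf.2 y) h)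
    obtain ⟨n, hn⟩ := exists_pow_lt_of_lt_one hε huy
    refine ⟨{z | ‖(u ^ n) z‖ < ε}, mem_nhdsWithin_of_mem_nhds ?_, u ^ n,
      ⟨A.pow_mem (half_one_add_mem hf.1) n, fun z => ?_⟩, fun z hz => ?_, fun z hz => le_of_lt hz⟩
    · refine (isOpen_lt (by fun_prop) continuous_const).mem_nhds ?_
      simpa using hn
    · rw [ContinuousMap.pow_apply, norm_pow]
      exact pow_le_one₀ (norm_nonneg _) (hu1 z)
    · have : u z = 1 := by
        simp only [hu, ContinuousMap.smul_apply, ContinuousMap.add_apply, ContinuousMap.one_apply,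
          hz f hfS, smul_eq_mul]
        norm_num
      rw [ContinuousMap.pow_apply, this, one_pow]

/-! ### Extension from intersections of peak sets -/

theorem hasSum_geometric_half : HasSum (fun n : ℕ => (1 / 2 : ℝ) ^ (n + 1)) 1 := by
  have := (hasSum_geometric_two).mul_right (1 / 2)
  norm_num at this
  simpa [pow_succ] using this

/-- The estimate behind the extension of functions from intersections of peak sets. -/
theorem tsum_half_pow_mul_le_one {a : ℕ → ℝ} {t : ℝ} (h0 : ∀ n, 0 ≤ a n) (ht : ∀ n, a n ≤ 1 + t)
    (hsmall : ∀ n : ℕ, (1 / 2 : ℝ) ^ n / 4 ≤ t → a n ≤ 1 / 2) :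
    ∑' n, (1 / 2 : ℝ) ^ (n + 1) * a n ≤ 1 := by
  have hsumm : Summable fun n => (1 / 2 : ℝ) ^ (n + 1) * a n :=
    (hasSum_geometric_half.summable.mul_right (1 + t)).of_nonneg_of_le
      (fun n => mul_nonneg (by positivity) (h0 n))
      (fun n => mul_le_mul_of_nonneg_left (ht n) (by positivity))
  rcases le_or_gt t 0 with h | h
  · refine (hsumm.tsum_le_tsum (fun n => ?_) hasSum_geometric_half.summable).trans
      hasSum_geometric_half.tsum_eq.le
    exact mul_le_of_le_one_right (by positivity) ((ht n).trans (by linarith))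
  have hex : ∃ n : ℕ, (1 / 2 : ℝ) ^ n / 4 ≤ t := by
    obtain ⟨n, hn⟩ := exists_pow_lt_of_lt_one (show 0 < 4 * t by linarith)
      (show (1 / 2 : ℝ) < 1 by norm_num)
    exact ⟨n, by linarith⟩
  classical
  -- Head terms are at most `1 + t`, tail terms at most 1/2. Minimality of `N` gives `t < 2^{-N}/2`
  -- when `N > 0`, so the tail's saving `2^{-N}/2` pays for the head's excess.
  set N := Nat.find hex with hN
  have hNt : (1 / 2 : ℝ) ^ N / 4 ≤ t := Nat.find_spec hex
  have hge : ∀ n, N ≤ n → a n ≤ 1 / 2 := fun n hn => hsmall n <| by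
    have : (1 / 2 : ℝ) ^ n ≤ (1 / 2) ^ N := pow_le_pow_of_le_one (by norm_num) (by norm_num) hn
    linarith
  have hhead : ∑ n ∈ Finset.range N, (1 / 2 : ℝ) ^ (n + 1) = 1 - (1 / 2) ^ N := by
    have : ∀ m : ℕ, ∑ n ∈ Finset.range m, (1 / 2 : ℝ) ^ (n + 1) = 1 - (1 / 2) ^ m := by
      intro m
      induction m with
      | zero => simp
      | succ m ih => rw [Finset.sum_range_succ, ih]; ring
    exact this N
  have hsum1 : ∑ n ∈ Finset.range N, (1 / 2 : ℝ) ^ (n + 1) * a n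
      ≤ (1 - (1 / 2) ^ N) * (1 + t) := by
    rw [← hhead, Finset.sum_mul]
    exact Finset.sum_le_sum fun n _ => mul_le_mul_of_nonneg_left (ht n) (by positivity)
  have hs2 : HasSum (fun n : ℕ => (1 / 2 : ℝ) ^ (n + N + 1) * (1 / 2)) ((1 / 2) ^ N * (1 / 2)) := by
    have := hasSum_geometric_half.mul_right ((1 / 2) ^ N * (1 / 2))
    rw [one_mul] at this
    have heq : (fun n : ℕ => (1 / 2 : ℝ) ^ (n + N + 1) * (1 / 2))
        = fun n => (1 / 2) ^ (n + 1) * ((1 / 2) ^ N * (1 / 2)) := by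
      funext n; ring
    rwa [heq]
  have hsum2 : ∑' n, (1 / 2 : ℝ) ^ (n + N + 1) * a (n + N) ≤ (1 / 2) ^ N * (1 / 2) := by
    rw [← hs2.tsum_eq]
    exact ((summable_nat_add_iff N).2 hsumm).tsum_le_tsum
      (fun n => mul_le_mul_of_nonneg_left (hge _ (Nat.le_add_left _ _)) (by positivity)) hs2.summable
  rw [← hsumm.sum_add_tsum_nat_add N]
  refine (add_le_add hsum1 hsum2).trans ?_
  rcases Nat.eq_zero_or_pos N with h0' | hpos
  · rw [h0']; norm_num
  · have hlt := Nat.find_min hex (Nat.sub_lt hpos one_pos)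
    rw [not_le, ← hN] at hlt
    have hp : (1 / 2 : ℝ) ^ N = (1 / 2) ^ (N - 1) * (1 / 2) := by
      rw [← pow_succ, Nat.sub_add_cancel hpos]
    have hq : 0 < (1 / 2 : ℝ) ^ N := by positivity
    nlinarith

/-- A function of `A` bounded by `1` on `peakOn S` agrees there with a function in `unitBall A`. -/
theorem exists_extension [CompactSpace K] {A : Subalgebra ℂ C(K, ℂ)}
    (hA : IsClosed (A : Set C(K, ℂ))) {S : Set C(K, ℂ)} (hS : S ⊆ unitBall A) {g : C(K, ℂ)}
    (hg : g ∈ A) (hg1 : ∀ y ∈ peakOn S, ‖g y‖ ≤ 1) :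
    ∃ h ∈ unitBall A, ∀ y ∈ peakOn S, h y = g y := by
  have hf : ∀ n : ℕ, ∃ f ∈ unitBall A, (∀ y ∈ peakOn S, f y = 1) ∧
      ∀ y, 1 + (1 / 2 : ℝ) ^ n / 4 ≤ ‖g y‖ → ‖f y * g y‖ ≤ 1 / 2 := by
    intro n
    have hpos : (0 : ℝ) < (1 / 2) ^ n / 4 := by positivity
    obtain ⟨f, hf, hf1, hf2⟩ := exists_small_off hS (V := {y | ‖g y‖ < 1 + (1 / 2 : ℝ) ^ n / 4})
      (isOpen_lt (by fun_prop) continuous_const)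
      (fun y hy => lt_of_le_of_lt (hg1 y hy) (by linarith))
      (ε := 1 / (2 * (‖g‖ + 1))) (by positivity)
    refine ⟨f, hf, hf1, fun y hy => ?_⟩
    rw [norm_mul]
    calc ‖f y‖ * ‖g y‖ ≤ 1 / (2 * (‖g‖ + 1)) * (‖g‖ + 1) := by
          refine mul_le_mul (hf2 y (not_lt.2 hy)) ?_ (norm_nonneg _) (by positivity)
          exact (g.norm_coe_le_norm y).trans (by linarith)
      _ = 1 / 2 := by field_simp
  choose f hfA hf1 hf2 using hf
  have hbound : ∀ n y, ‖f n y * g y‖ ≤ ‖g y‖ := fun n y => by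
    rw [norm_mul]
    exact mul_le_of_le_one_left (norm_nonneg _) ((hfA n).2 y)
  -- The extension is `∑ 2^{-(n+1)} f_n g`: the `f_n` damp `g` where it exceeds 1, with thresholds
  -- shrinking to 1.
  obtain ⟨F, hF⟩ : ∃ F : ℕ → C(K, ℂ), ∀ n, F n = ((1 / 2 : ℝ) ^ (n + 1) : ℂ) • (f n * g) :=
    ⟨_, fun _ => rfl⟩
  have hFy : ∀ n y, F n y = ((1 / 2 : ℝ) ^ (n + 1) : ℂ) * (f n y * g y) := fun n y => by
    rw [hF, ContinuousMap.smul_apply, ContinuousMap.mul_apply, smul_eq_mul]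
  have hcoef : ∀ n : ℕ, ‖((1 / 2 : ℝ) ^ (n + 1) : ℂ)‖ = (1 / 2 : ℝ) ^ (n + 1) := fun n => by
    rw [norm_pow, Complex.norm_real, Real.norm_of_nonneg (by norm_num)]
  have hFsum : Summable F := by
    refine Summable.of_norm_bounded (hasSum_geometric_half.summable.mul_right ‖g‖) fun n => ?_
    rw [hF, norm_smul, hcoef]
    refine mul_le_mul_of_nonneg_left ?_ (by positivity)
    exact (ContinuousMap.norm_le _ (norm_nonneg _)).2 fun y =>
      (hbound n y).trans (g.norm_coe_le_norm y)
  have hev : ∀ y, HasSum (fun n => F n y) ((∑' n, F n) y) := fun y =>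
    (ContinuousMap.evalCLM ℂ y).hasSum hFsum.hasSum
  refine ⟨∑' n, F n, ⟨?_, fun y => ?_⟩, fun y hy => ?_⟩
  · exact hA.mem_of_tendsto hFsum.hasSum (Eventually.of_forall fun s =>
      A.sum_mem fun n _ => hF n ▸ A.smul_mem (A.mul_mem (hfA n).1 hg) _)
  · have hterm : ∀ n, ‖F n y‖ = (1 / 2 : ℝ) ^ (n + 1) * ‖f n y * g y‖ := fun n => by
      rw [hFy, norm_mul, hcoef]
    rw [← (hev y).tsum_eq]
    refine (norm_tsum_le_tsum_norm ?_).trans ?_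
    · simp_rw [hterm]
      exact (hasSum_geometric_half.summable.mul_right ‖g y‖).of_nonneg_of_le
        (fun n => by positivity)
        (fun n => mul_le_mul_of_nonneg_left (hbound n y) (by positivity))
    · simp_rw [hterm]
      exact tsum_half_pow_mul_le_one (t := ‖g y‖ - 1) (fun n => norm_nonneg _)
        (fun n => by linarith [hbound n y]) (fun n hn => hf2 n y (by linarith))
  · rw [← (hev y).tsum_eq]
    have h1 : HasSum (fun n => ((1 / 2 : ℝ) ^ (n + 1) : ℂ)) 1 := by
      simpa only [Complex.ofReal_pow, Complex.ofReal_one] using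
        Complex.hasSum_ofReal.2 hasSum_geometric_half
    have h2 := h1.mul_right (g y)
    rw [one_mul] at h2
    simp_rw [hFy, hf1 _ y hy, one_mul]
    exact h2.tsum_eq

/-! ### Peak sets and strong boundary points -/

theorem isClosed_peakOn (S : Set C(K, ℂ)) : IsClosed (peakOn S) := by
  simp only [peakOn, ofPred_forall]
  exact isClosed_biInter fun f _ => isClosed_eq f.continuous continuous_const

theorem isPeakSet_eq_one {A : Subalgebra ℂ C(K, ℂ)} {f : C(K, ℂ)} (hf : f ∈ unitBall A) :
    IsPeakSet A {y | f y = 1} := by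
  refine ⟨isClosed_eq f.continuous continuous_const, (1 / 2 : ℂ) • (1 + f),
    half_one_add_mem hf.1, fun y hy => ?_, fun y hy => ?_⟩
  · have hy : f y = 1 := hy
    rw [ContinuousMap.smul_apply, ContinuousMap.add_apply, hy]
    norm_num
  · by_contra! h
    exact hy (eq_one_of_norm_half_one_add (hf.2 y) h)

theorem mem_strongBoundary_of_peakOn_eq {A : Subalgebra ℂ C(K, ℂ)} {S : Set C(K, ℂ)}
    (hS : S ⊆ unitBall A) {x : K} (hx : peakOn S = {x}) : x ∈ strongBoundary A := by
  refine ⟨(fun f : C(K, ℂ) => {y | f y = 1}) '' S, ?_, ?_⟩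
  · rintro _ ⟨f, hf, rfl⟩
    exact isPeakSet_eq_one (hS hf)
  · rw [← hx]
    ext y
    simp [peakOn]

/-- A function `f` peaking on `F ∋ x` can be divided by the unimodular number `f x`; the quotient is
1 at `x` and still has modulus below 1 off `F`. -/
theorem peakOn_eq_of_mem_strongBoundary {A : Subalgebra ℂ C(K, ℂ)} {x : K}
    (hx : x ∈ strongBoundary A) : peakOn {f ∈ unitBall A | f x = 1} = {x} := by
  obtain ⟨𝓕, h𝓕, hI⟩ := hx
  refine Subset.antisymm (fun y hy => ?_) (by rintro _ rfl f hf; exact hf.2)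
  rw [← hI]
  intro F hF
  have hxF : x ∈ F := (hI.ge rfl : x ∈ ⋂₀ 𝓕) F hF
  obtain ⟨-, f, hfA, hf1, hf2⟩ := h𝓕 F hF
  have hfx := hf1 x hxF
  have hfx0 : f x ≠ 0 := norm_ne_zero_iff.1 (by rw [hfx]; exact one_ne_zero)
  by_contra hyF
  have hle : ∀ z, ‖f z‖ ≤ 1 := fun z => by
    by_cases hz : z ∈ F
    · exact (hf1 z hz).le
    · exact (hf2 z hz).le
  have hnorm : ∀ z, ‖((f x)⁻¹ • f) z‖ = ‖f z‖ := fun z => by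
    rw [ContinuousMap.smul_apply, norm_smul, norm_inv, hfx, inv_one, one_mul]
  have := hy ((f x)⁻¹ • f) ⟨⟨A.smul_mem hfA _, fun z => (hnorm z).trans_le (hle z)⟩,
    inv_mul_cancel₀ hfx0⟩
  have h1 := hnorm y
  rw [this, norm_one] at h1
  exact absurd h1 (hf2 y hyF).ne'

/-- A nonempty intersection of peak sets contains a strong boundary point. -/
theorem exists_mem_strongBoundary [CompactSpace K] {A : Subalgebra ℂ C(K, ℂ)}
    (hA : IsUniformAlgebra A) {S : Set C(K, ℂ)} (hS : S ⊆ unitBall A) (hne : (peakOn S).Nonempty) :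
    ∃ x ∈ peakOn S, x ∈ strongBoundary A := by
  obtain ⟨M, hSM, hM⟩ := zorn_subset_nonempty
    {T : Set C(K, ℂ) | T ⊆ unitBall A ∧ (peakOn T).Nonempty} (by
      intro c hc hchain hcne
      have := hcne.to_subtype
      refine ⟨⋃₀ c, ⟨sUnion_subset fun T hT => (hc hT).1, ?_⟩, fun T hT => subset_sUnion_of_mem hT⟩
      obtain ⟨y, hy⟩ := IsCompact.nonempty_iInter_of_directed_nonempty_isCompact_isClosed
        (fun T : c => peakOn (T : Set C(K, ℂ)))
        (by
          intro T U
          rcases hchain.total T.2 U.2 with h | h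
          · exact ⟨U, fun y hy f hf => hy f (h hf), Subset.rfl⟩
          · exact ⟨T, Subset.rfl, fun y hy f hf => hy f (h hf)⟩)
        (fun T => (hc T.2).2) (fun T => (isClosed_peakOn _).isCompact) (fun T => isClosed_peakOn _)
      rw [mem_iInter] at hy
      exact ⟨y, fun f ⟨T, hT, hf⟩ => hy ⟨T, hT⟩ f hf⟩) S ⟨hS, hne⟩
  obtain ⟨hMA, hMne⟩ := hM.prop
  have hconst : ∀ g ∈ A, ∀ y ∈ peakOn M, ∀ z ∈ peakOn M, g y = g z := by
    intro g hg
    obtain ⟨x, hx, hmax⟩ := (isClosed_peakOn M).isCompact.exists_isMaxOn hMne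
      (f := fun y => ‖g y‖) (by fun_prop)
    suffices h : ∀ y ∈ peakOn M, g y = g x from fun y hy z hz => (h y hy).trans (h z hz).symm
    intro y hy
    by_cases h0 : g x = 0
    · have : ‖g y‖ ≤ ‖g x‖ := hmax hy
      rw [h0, norm_zero] at this
      rw [h0, norm_le_zero_iff.1 this]
    · obtain ⟨h, hh, hhg⟩ := exists_extension hA.isClosed hMA (g := (g x)⁻¹ • g)
        (A.smul_mem hg _) (fun z hz => by
          rw [ContinuousMap.smul_apply, norm_smul, norm_inv]
          exact inv_mul_le_one_of_le₀ (hmax hz) (norm_nonneg _))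
      -- `h` equals 1 at the maximum point `x`, so adjoining it keeps the common set nonempty;
      -- maximality of `M` then forces `h = 1` on all of `peakOn M`.
      have hmem : insert h M ∈ {T : Set C(K, ℂ) | T ⊆ unitBall A ∧ (peakOn T).Nonempty} := by
        refine ⟨insert_subset hh hMA, x, ?_⟩
        rintro f (rfl | hf)
        · rw [hhg x hx]
          exact inv_mul_cancel₀ h0
        · exact hx f hf
      have hhM : h ∈ M := hM.le_of_ge hmem (subset_insert _ _) (mem_insert _ _)
      have h1 : (g x)⁻¹ * g y = 1 := (hhg y hy).symm.trans (hy h hhM)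
      rw [inv_mul_eq_iff_eq_mul₀ h0, mul_one] at h1
      exact h1
  obtain ⟨x, hx⟩ := hMne
  refine ⟨x, fun f hf => hx f (hSM hf), mem_strongBoundary_of_peakOn_eq hMA ?_⟩
  refine Subset.antisymm (fun y hy => ?_) (singleton_subset_iff.2 hx)
  by_contra hyx
  obtain ⟨f, ⟨g, hg, rfl⟩, hfg⟩ := hA.separatesPoints hyx
  exact hfg (hconst g hg y hy x hx)

/-! ### Countable generation forces isolation -/

/-- If `M_x` is countably generated, its elements are uniformly dominated by a continuous weight
vanishing at `x`. -/
theorem exists_weight [CompactSpace K] {A : Subalgebra ℂ C(K, ℂ)}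
    (hA : IsClosed (A : Set C(K, ℂ))) {x : K} (hgen : IsCountablyGenerated (maxIdeal A x)) :
    ∃ w : K → ℝ, Continuous w ∧ w x = 0 ∧ ∃ C : ℝ, 0 ≤ C ∧
      ∀ g ∈ A, g x = 0 → ∀ y, ‖g y‖ ≤ C * ‖g‖ * w y := by
  obtain ⟨S, hSc, hspan⟩ := hgen
  -- Adjoining 0 allows enumeration even when `S` is empty.
  obtain ⟨s, hs⟩ := (hSc.insert 0).exists_eq_range (insert_nonempty _ _)
  have hsx : ∀ n, (s n : C(K, ℂ)) x = 0 := fun n => by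
    have h : s n ∈ insert 0 S := hs ▸ mem_range_self n
    have : s n ∈ maxIdeal A x := by
      rcases h with h | h
      · rw [h]; exact Ideal.zero_mem _
      · rw [← hspan]; exact Ideal.subset_span h
    exact this
  set c : ℕ → ℝ := fun n => (1 / 2) ^ (n + 1) / (‖(s n : C(K, ℂ))‖ + 1) with hc
  have hcpos : ∀ n, 0 < c n := fun n => by positivity
  have hle : ∀ n y, ‖c n * ‖(s n : C(K, ℂ)) y‖‖ ≤ (1 / 2) ^ (n + 1) := fun n y => by
    have h1 := (s n : C(K, ℂ)).norm_coe_le_norm y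
    rw [Real.norm_of_nonneg (mul_nonneg (hcpos n).le (norm_nonneg _)), hc, div_mul_eq_mul_div,
      div_le_iff₀ (by positivity)]
    exact mul_le_mul_of_nonneg_left (by linarith) (by positivity)
  set w : K → ℝ := fun y => ∑' n, c n * ‖(s n : C(K, ℂ)) y‖ with hw
  have hsumm : ∀ y, Summable fun n => c n * ‖(s n : C(K, ℂ)) y‖ := fun y =>
    Summable.of_norm_bounded hasSum_geometric_half.summable fun n => hle n y
  have hw0 : ∀ y, 0 ≤ w y := fun y =>
    tsum_nonneg fun n => mul_nonneg (hcpos n).le (norm_nonneg _)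
  have hdom : ∀ g : A, g ∈ maxIdeal A x → ∃ C : ℝ, ∀ y, ‖(g : C(K, ℂ)) y‖ ≤ C * w y := by
    intro g hg
    rw [← hspan] at hg
    induction hg using Submodule.span_induction with
    | mem f hf =>
      obtain ⟨n, rfl⟩ : f ∈ range s := hs ▸ mem_insert_of_mem _ hf
      refine ⟨(c n)⁻¹, fun y => ?_⟩
      rw [← div_eq_inv_mul, le_div_iff₀ (hcpos n), mul_comm]
      exact (hsumm y).le_tsum n fun m _ => mul_nonneg (hcpos m).le (norm_nonneg _)
    | zero => exact ⟨0, by simp⟩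
    | add f g _ _ hf hg =>
      obtain ⟨C, hC⟩ := hf
      obtain ⟨D, hD⟩ := hg
      refine ⟨C + D, fun y => ?_⟩
      rw [add_mul]
      exact (norm_add_le _ _).trans (add_le_add (hC y) (hD y))
    | smul a f _ hf =>
      obtain ⟨C, hC⟩ := hf
      refine ⟨‖(a : C(K, ℂ))‖ * C, fun y => ?_⟩
      rw [mul_assoc]
      refine (norm_mul_le _ _).trans ?_
      exact mul_le_mul ((a : C(K, ℂ)).norm_coe_le_norm y) (hC y) (norm_nonneg _) (norm_nonneg _)
  let M : Submodule ℂ C(K, ℂ) :=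
    Subalgebra.toSubmodule A ⊓
      LinearMap.ker (ContinuousMap.evalCLM ℂ x : C(K, ℂ) →L[ℂ] ℂ).toLinearMap
  have hMcl : IsClosed (M : Set C(K, ℂ)) :=
    hA.inter (ContinuousMap.evalCLM ℂ x : C(K, ℂ) →L[ℂ] ℂ).isClosed_ker
  have : CompleteSpace M := hMcl.completeSpace_coe
  have hMdom : ∀ g : M, ∃ C : ℝ, ∀ y, ‖(g : C(K, ℂ)) y‖ ≤ C * w y := fun g =>
    hdom ⟨g, g.2.1⟩ g.2.2
  -- The functionals are `g ↦ g y / w y`. Where `w y = 0` the inverse is 0 and this bound says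
  -- nothing; there `hMdom` gives `g y = 0` directly.
  obtain ⟨C, hC⟩ := banach_steinhaus
    (g := fun y : K => ((w y : ℂ)⁻¹) •
      (ContinuousMap.evalCLM ℂ y : C(K, ℂ) →L[ℂ] ℂ).comp M.subtypeL) (fun g => by
    obtain ⟨C, hC⟩ := hMdom g
    refine ⟨max C 0, fun y => ?_⟩
    change ‖(w y : ℂ)⁻¹ * (g : C(K, ℂ)) y‖ ≤ _
    rw [norm_mul, norm_inv, Complex.norm_real, Real.norm_of_nonneg (hw0 y)]
    rcases (hw0 y).eq_or_lt with h | h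
    · rw [← h]; simp
    · rw [inv_mul_le_iff₀ h, mul_comm]
      exact (hC y).trans (mul_le_mul_of_nonneg_right (le_max_left _ _) h.le))
  refine ⟨w, continuous_tsum (fun n => by fun_prop) hasSum_geometric_half.summable hle,
    by simp [hw, hsx], max C 0, le_max_right _ _, fun g hg hgx y => ?_⟩
  rcases (hw0 y).eq_or_lt with h | h
  · obtain ⟨D, hD⟩ := hMdom ⟨g, hg, hgx⟩
    simpa [← h] using hD y
  · have h1 := (ContinuousLinearMap.le_of_opNorm_le _ (hC y) (⟨g, hg, hgx⟩ : M))
    change ‖(w y : ℂ)⁻¹ * g y‖ ≤ C * ‖g‖ at h1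
    rw [norm_mul, norm_inv, Complex.norm_real, Real.norm_of_nonneg (hw0 y),
      inv_mul_le_iff₀ h, mul_comm] at h1
    exact h1.trans (mul_le_mul_of_nonneg_right
      (mul_le_mul_of_nonneg_right (le_max_left _ _) (norm_nonneg _)) h.le)

/-- A strong boundary point with countably generated maximal ideal is isolated. -/
theorem isOpen_singleton_of_isCountablyGenerated [CompactSpace K] [T2Space K]
    {A : Subalgebra ℂ C(K, ℂ)} (hA : IsClosed (A : Set C(K, ℂ))) {x : K}
    (hx : x ∈ strongBoundary A) (hgen : IsCountablyGenerated (maxIdeal A x)) :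
    IsOpen ({x} : Set K) := by
  obtain ⟨w, hwc, hwx, C, hC0, hC⟩ := exists_weight hA hgen
  have hpk := peakOn_eq_of_mem_strongBoundary hx
  have hopen : IsOpen {y | C * 2 * w y < 1 / 2} := isOpen_lt (by fun_prop) continuous_const
  convert hopen using 1
  refine Subset.antisymm (singleton_subset_iff.2 (by simp [hwx])) fun y hy => ?_
  by_contra hyx
  obtain ⟨f, hf, hf1, hf2⟩ := exists_small_off (A := A) (sep_subset _ _)
    (isOpen_compl_singleton (x := y))
    (by rw [hpk, singleton_subset_iff]; exact fun h => hyx h.symm) (ε := 1 / 2) (by norm_num)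
  have hfx : f x = 1 := hf1 x (by rw [hpk]; rfl)
  have hfy : ‖f y‖ ≤ 1 / 2 := hf2 y (by simp)
  have hnorm : ‖1 - f‖ ≤ 2 := by
    refine (ContinuousMap.norm_le _ (by norm_num)).2 fun z => ?_
    have h1 := norm_sub_le (1 : ℂ) (f z)
    have h2 := hf.2 z
    rw [norm_one] at h1
    exact h1.trans (by linarith)
  have h1 := hC (1 - f) (A.sub_mem A.one_mem hf.1) (by simp [hfx]) y
  have h2 : 1 / 2 ≤ ‖(1 - f) y‖ := by
    have := norm_sub_norm_le (1 : ℂ) (f y)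
    rw [norm_one] at this
    exact le_trans (by linarith) this
  have hy : C * 2 * w y < 1 / 2 := hy
  have hw : 0 ≤ w y ∨ w y < 0 := le_or_gt _ _
  rcases hw with hw | hw
  · have : C * ‖1 - f‖ * w y ≤ C * 2 * w y :=
      mul_le_mul_of_nonneg_right (mul_le_mul_of_nonneg_left hnorm hC0) hw
    linarith
  · have : C * ‖1 - f‖ * w y ≤ 0 :=
      mul_nonpos_of_nonneg_of_nonpos (mul_nonneg hC0 (norm_nonneg _)) hw.le
    linarith

/-! ### Indicators and finiteness -/

/-- The indicator function of an isolated strong boundary point belongs to `A`. -/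
theorem exists_indicator_mem [CompactSpace K] [T2Space K]
    {A : Subalgebra ℂ C(K, ℂ)} (hA : IsClosed (A : Set C(K, ℂ))) {x : K}
    (hx : x ∈ strongBoundary A) (hopen : IsOpen ({x} : Set K)) :
    ∃ e ∈ A, e x = 1 ∧ ∀ y ≠ x, e y = 0 := by
  classical
  have hclopen : IsClopen ({x} : Set K) := ⟨isClosed_singleton, hopen⟩
  let e : C(K, ℂ) := ⟨indicator {x} fun _ => 1,
    continuous_const.indicator (by simp [hclopen.frontier_eq])⟩
  have hex : e x = 1 := indicator_of_mem (mem_singleton x) (fun _ => (1 : ℂ))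
  have hey : ∀ y ≠ x, e y = 0 := fun y hy =>
    indicator_of_notMem (mem_singleton_iff.not.2 hy) (fun _ => (1 : ℂ))
  have hpk := peakOn_eq_of_mem_strongBoundary hx
  refine ⟨e, ?_, hex, hey⟩
  rw [← SetLike.mem_coe, ← hA.closure_eq, Metric.mem_closure_iff]
  intro ε hε
  -- As `{x}` is itself a neighbourhood, `f` is 1 at `x` and at most `ε / 2` elsewhere: uniformly
  -- close to `e`.
  obtain ⟨f, hf, hf1, hf2⟩ := exists_small_off (A := A) (sep_subset _ _) hopen hpk.subset
    (half_pos hε)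
  refine ⟨f, hf.1, lt_of_le_of_lt ?_ (half_lt_self hε)⟩
  refine (ContinuousMap.dist_le (half_pos hε).le).2 fun y => ?_
  by_cases hy : y = x
  · rw [hy, hex, hf1 x (by rw [hpk]; rfl), dist_self]
    exact (half_pos hε).le
  · rw [hey y hy, dist_zero_left]
    exact hf2 y hy

/-- If every strong boundary point has countably generated maximal ideal, then every point of `K`
is a strong boundary point. -/
theorem strongBoundary_eq_univ [CompactSpace K] [T2Space K] {A : Subalgebra ℂ C(K, ℂ)}
    (hA : IsUniformAlgebra A)
    (hgen : ∀ x ∈ strongBoundary A, IsCountablyGenerated (maxIdeal A x)) :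
    strongBoundary A = univ := by
  have hind : ∀ x : strongBoundary A, ∃ e ∈ A, e x = 1 ∧ ∀ y ≠ (x : K), e y = 0 := fun x =>
    exists_indicator_mem hA.isClosed x.2
      (isOpen_singleton_of_isCountablyGenerated hA.isClosed x.2 (hgen x x.2))
  choose e heA he1 he0 using hind
  rw [eq_univ_iff_forall]
  by_contra! h
  obtain ⟨y, hy⟩ := h
  have hball : range (fun x => 1 - e x) ⊆ unitBall A := by
    rintro _ ⟨x, rfl⟩
    refine ⟨A.sub_mem A.one_mem (heA x), fun z => ?_⟩
    by_cases hz : z = x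
    · simp [hz, he1]
    · simp [he0 x z hz]
  obtain ⟨x, hx, hxS⟩ := exists_mem_strongBoundary hA hball ⟨y, by
    rintro _ ⟨x, rfl⟩
    have : y ≠ x := fun h => hy (h ▸ x.2)
    simp [he0 x y this]⟩
  have := hx _ ⟨⟨x, hxS⟩, rfl⟩
  simp [he1 ⟨x, hxS⟩] at this

end UniformAlg

theorem theorem3 {K : Type*} [TopologicalSpace K] [CompactSpace K] [T2Space K] [Nonempty K]
    (A : Subalgebra ℂ C(K, ℂ))
    (hA : UniformAlg.IsUniformAlgebra A)
    (hnat : UniformAlg.IsNatural A)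
    (hcount : (UniformAlg.strongBoundary A).Countable)
    (hgen : ∀ x ∈ UniformAlg.strongBoundary A,
      UniformAlg.IsCountablyGenerated (UniformAlg.maxIdeal A x)) :
    FiniteDimensional ℂ A := by
  have huniv := UniformAlg.strongBoundary_eq_univ hA hgen
  have hdisc : DiscreteTopology K := discreteTopology_iff_isOpen_singleton.2 fun x =>
    have hx : x ∈ UniformAlg.strongBoundary A := huniv ▸ mem_univ x
    UniformAlg.isOpen_singleton_of_isCountablyGenerated hA.isClosed hx (hgen x hx)
  have hfin : Finite K := finite_of_compact_of_discrete
  have : FiniteDimensional ℂ C(K, ℂ) :=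
    Module.Finite.of_injective (ContinuousMap.coeFnLinearMap ℂ) DFunLike.coe_injective
  exact FiniteDimensional.finiteDimensional_submodule (Subalgebra.toSubmodule A)
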